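/- Let $p_1=2<p_2=3<p_3=5<\cdots$ be the sequence of all primes and, for $n\ge 1$, put $$A_n=\sum_{i=1}^{2n}(-1)^i p_i,\qquad T_n=\sum_{i=2}^{2n}(-1)^i p_i .$$ For real sequences, $u_n\sim v_n$ means $u_n-v_n=o(v_n)$ as $n\to\infty$. Assume Pillai's conjecture, that is, $$\Bigl|\sum_{i=1}^{k}(-1)^{i-1}p_i\Bigr|\sim\frac{p_k}{2}\qquad (k\to\infty).$$ Then $$A_n\sim T_n\sim n\log n\qquad (n\to\infty).$$ Moreover $$A_n\sim T_n\sim n\log n+n\log\log n-n+o(n)\qquad (n\to\infty),$$ in the sense that for every real sequence $e_n$ with $e_n=o(n)$ one has $A_n\sim n\log n+n\log\log n-n+e_n$ and $T_n\sim n\log n+n\log\log n-n+e_n$. -/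

import Mathlib

open Filter Asymptotics

/-- The `i`-th prime in the numbering `p_1 = 2 < p_2 = 3 < p_3 = 5 < ...`; only `i ≥ 1` is used. -/
noncomputable def nthPrime (i : ℕ) : ℕ := Nat.nth Nat.Prime (i - 1)

/-- `A_n = ∑_{i=1}^{2n} (-1)^i p_i`. -/
noncomputable def altA (n : ℕ) : ℤ := ∑ i ∈ Finset.Icc 1 (2 * n), (-1) ^ i * (nthPrime i : ℤ)

/-- `T_n = ∑_{i=2}^{2n} (-1)^i p_i`. -/
noncomputable def altT (n : ℕ) : ℤ := ∑ i ∈ Finset.Icc 2 (2 * n), (-1) ^ i * (nthPrime i : ℤ)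

/-- Pillai's conjecture: `|∑_{i ≤ k} (-1)^(i-1) p_i| ~ p_k / 2` as `k → ∞`. -/
def PillaiConjecture : Prop :=
  IsEquivalent atTop
    (fun k : ℕ => |∑ i ∈ Finset.Icc 1 k, (-1 : ℝ) ^ (i - 1) * (nthPrime i : ℝ)|)
    (fun k : ℕ => (nthPrime k : ℝ) / 2)

/-!
Each `A_n` is a sum of prime gaps `p_{2i} - p_{2i-1}`, hence nonnegative, so it equals the absolute
value of the alternating sum of the first `2n` primes, and Pillai's conjecture gives
`A_n ~ p_{2n} / 2`. With the prime number theorem in the form `p_n ~ n log n`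
(`nthPrime_isEquivalent`) this is `~ n log n`. The rest is soft: `T_n = A_n + 2`, and
`n log log n - n + e_n` is `o(n log n)`, so adding it does not change the equivalence class.

The prime number theorem is proved here by the Wiener–Ikehara method
(`tendsto_one_of_continuousOn_laplace`). Put `φ u = ψ(eᵘ) / eᵘ`. The Laplace transform of `φ - 1`
is `(-ζ'/ζ(1 + s) - 1/s - 1) / (1 + s)`, which extends continuously to `Re s ≥ 0` because `ζ` does
not vanish on `Re s = 1`. The Fejér kernel is the Fourier transform of the compactly
supported triangle function, so an average of `φ - 1` against a translate of the Fejér kernel is a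
Fourier integral of the boundary values of that extension, and tends to `0` by the
Riemann–Lebesgue lemma (`tendsto_integral_mul_fejerKernel`). The same holds at every scale. Since
`φ u * eᵘ` is monotone, `φ` varies slowly over short intervals and the averages at small scales
force `φ → 1`. Chebyshev's bound `ψ x = O(x)` justifies the limits under the integral signs.
-/

open MeasureTheory Topology

/-! ### The Fejér kernel -/

/-- The triangle function `max (0, 1 - |t|)`, supported on `[-1, 1]`. -/
noncomputable def triangle (t : ℝ) : ℝ := max 0 (1 - |t|)

/-- The Fejér kernel `(sin (u/2) / (u/2))²`, normalised as the Fourier transform of `triangle`;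
`Real.sinc` supplies the value `1` at `0`. -/
noncomputable def fejerKernel (u : ℝ) : ℝ := Real.sinc (u / 2) ^ 2

lemma continuous_triangle : Continuous triangle := by
  unfold triangle; fun_prop

lemma continuous_fejerKernel : Continuous fejerKernel :=
  (Real.continuous_sinc.comp (continuous_id.div_const 2)).pow 2

lemma fejerKernel_nonneg (u : ℝ) : 0 ≤ fejerKernel u := sq_nonneg _

lemma fejerKernel_neg (u : ℝ) : fejerKernel (-u) = fejerKernel u := by
  simp [fejerKernel, neg_div]

lemma triangle_nonneg (t : ℝ) : 0 ≤ triangle t := le_max_left _ _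

lemma triangle_eq_zero {t : ℝ} (ht : 1 ≤ |t|) : triangle t = 0 :=
  max_eq_left (by linarith)

lemma triangle_of_abs_le_one {t : ℝ} (ht : |t| ≤ 1) : triangle t = 1 - |t| :=
  max_eq_right (by linarith)

lemma hasCompactSupport_triangle : HasCompactSupport triangle := by
  refine HasCompactSupport.intro (isCompact_Icc (a := -1) (b := 1)) fun t ht => triangle_eq_zero ?_
  by_contra! h
  exact ht (abs_le.1 h.le)

lemma integrable_triangle : Integrable triangle :=
  continuous_triangle.integrable_of_hasCompactSupport hasCompactSupport_triangle

lemma integrable_fejerKernel : Integrable fejerKernel := by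
  have h : Integrable (fun u : ℝ => 2 * (1 + (u / 2) ^ 2)⁻¹) :=
    (integrable_inv_one_add_sq.comp_div (two_ne_zero)).const_mul 2
  refine h.mono' continuous_fejerKernel.aestronglyMeasurable (Eventually.of_forall fun u => ?_)
  rw [Real.norm_of_nonneg (fejerKernel_nonneg u), ← div_eq_mul_inv, le_div_iff₀ (by positivity)]
  have h1 : Real.sinc (u / 2) ^ 2 ≤ 1 := by
    rw [sq_le_one_iff_abs_le_one]; exact Real.abs_sinc_le_one _
  have h2 : Real.sinc (u / 2) ^ 2 * (u / 2) ^ 2 ≤ 1 := by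
    rcases eq_or_ne (u / 2) 0 with h | h
    · simp [h]
    · rw [Real.sinc_of_ne_zero h, ← mul_pow, div_mul_cancel₀ _ h]
      exact Real.sin_sq_le_one _
  unfold fejerKernel
  linarith

lemma integral_fejerKernel_pos : 0 < ∫ u, fejerKernel u :=
  integral_pos_of_integrable_nonneg_nonzero continuous_fejerKernel integrable_fejerKernel
    fejerKernel_nonneg (x := 0) (by simp [fejerKernel])

lemma integral_triangle_mul_cexp (u : ℝ) :
    ∫ t, (triangle t : ℂ) * Complex.exp (Complex.I * t * u) = fejerKernel u := by
  have hcos : ∫ t in (0 : ℝ)..1, (1 - t) * Real.cos (t * u) = fejerKernel u / 2 := by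
    rcases eq_or_ne u 0 with rfl | hu
    · have : ∫ t in (0 : ℝ)..1, (1 - t) = 1 / 2 := by
        rw [intervalIntegral.integral_sub (by simp) (by simp)]; norm_num
      simpa [fejerKernel] using this
    have hd : ∀ t ∈ Set.uIcc (0 : ℝ) 1,
        HasDerivAt (fun t => (1 - t) * (Real.sin (t * u) / u) - Real.cos (t * u) / u ^ 2)
          ((1 - t) * Real.cos (t * u)) t := by
      intro t _
      have h1 : HasDerivAt (fun t : ℝ => t * u) u t := by
        simpa using (hasDerivAt_id t).mul_const u
      have h2 := ((hasDerivAt_id t).const_sub 1).mul (h1.sin.div_const u)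
      have h3 := h2.sub (h1.cos.div_const (u ^ 2))
      convert! h3 using 1
      simp only [id]
      field_simp
      ring
    rw [intervalIntegral.integral_eq_sub_of_hasDerivAt hd
      (Continuous.intervalIntegrable (by fun_prop) _ _)]
    have hu2 : u / 2 ≠ 0 := by positivity
    rw [fejerKernel, Real.sinc_of_ne_zero hu2, div_pow, Real.sin_sq_eq_half_sub,
      mul_div_cancel₀ _ (two_ne_zero)]
    simp
    field_simp
    ring
  have hi : Continuous fun t : ℝ => (triangle t : ℂ) * Complex.exp (Complex.I * t * u) := by
    have := continuous_triangle
    fun_prop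
  have hsupp : Function.support
      (fun t : ℝ => (triangle t : ℂ) * Complex.exp (Complex.I * t * u)) ⊆ Set.Ioc (-1) 1 := by
    intro t ht
    have : |t| < 1 := by
      by_contra! h
      exact ht (by simp [triangle_eq_zero h])
    exact ⟨(abs_lt.1 this).1, (abs_lt.1 this).2.le⟩
  rw [← intervalIntegral.integral_eq_integral_of_support_subset hsupp,
    ← intervalIntegral.integral_add_adjacent_intervals (b := 0)
      (hi.intervalIntegrable _ _) (hi.intervalIntegrable _ _)]
  -- Fold `[-1, 0]` onto `[0, 1]`, so that the two exponentials combine to a cosine.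
  have hneg : ∫ t in (-1 : ℝ)..0, (triangle t : ℂ) * Complex.exp (Complex.I * t * u) =
      ∫ t in (0 : ℝ)..1, (triangle t : ℂ) * Complex.exp (-(Complex.I * t * u)) := by
    have := intervalIntegral.integral_comp_neg (a := 0) (b := 1)
      (fun t : ℝ => (triangle t : ℂ) * Complex.exp (Complex.I * t * u))
    rw [neg_zero] at this
    rw [← this]
    simp [triangle]
  have hi' : Continuous fun t : ℝ => (triangle t : ℂ) * Complex.exp (-(Complex.I * t * u)) := by
    have := continuous_triangle
    fun_prop
  rw [hneg, ← intervalIntegral.integral_add (hi'.intervalIntegrable _ _)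
    (hi.intervalIntegrable _ _)]
  have : ((fejerKernel u : ℝ) : ℂ) =
      ((∫ t in (0 : ℝ)..1, 2 * ((1 - t) * Real.cos (t * u)) : ℝ) : ℂ) := by
    rw [intervalIntegral.integral_const_mul, hcos]; push_cast; ring
  rw [this, ← intervalIntegral.integral_ofReal]
  refine intervalIntegral.integral_congr fun t ht => ?_
  rw [Set.uIcc_of_le zero_le_one] at ht
  simp only [triangle_of_abs_le_one (t := t) (by rw [abs_of_nonneg ht.1]; exact ht.2),
      abs_of_nonneg ht.1]
  push_cast
  rw [Complex.cos]
  ring_nf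

/-! ### Fejér averages and boundary values of the Laplace transform -/

/-- Fubini: averaging a damped bounded function against a translated Fejér kernel is the same as
integrating its Laplace transform along a vertical segment against the triangle function. -/
lemma integral_mul_exp_mul_fejerKernel {f : ℝ → ℝ} {C : ℝ} (hm : Measurable f)
    (hb : ∀ u, |f u| ≤ C) {σ : ℝ} (hσ : 0 < σ) (y : ℝ) :
    ∫ u in Set.Ioi (0 : ℝ), ((f u * Real.exp (-(σ * u)) * fejerKernel (u - y) : ℝ) : ℂ) =
      ∫ t : ℝ, (triangle t : ℂ) * Complex.exp (Complex.I * t * y) *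
        ∫ u in Set.Ioi (0 : ℝ), (f u : ℂ) * Complex.exp (-((σ + Complex.I * t) * u)) := by
  have hint : IntegrableOn (fun u : ℝ => f u * Real.exp (-(σ * u))) (Set.Ioi 0) := by
    have h1 : IntegrableOn (fun u : ℝ => Real.exp (-σ * u)) (Set.Ioi 0) :=
      exp_neg_integrableOn_Ioi 0 hσ
    refine (h1.bdd_mul (c := C) hm.aestronglyMeasurable
      (Eventually.of_forall fun u => hb u)).congr (Eventually.of_forall fun u => ?_)
    simp
  have hprod : Integrable (Function.uncurry fun (u t : ℝ) =>
      ((f u * Real.exp (-(σ * u)) : ℝ) : ℂ) *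
        ((triangle t : ℂ) * Complex.exp (Complex.I * t * (y - u))))
      ((volume.restrict (Set.Ioi 0)).prod volume) := by
    have h2 := (hint.ofReal (𝕜 := ℂ)).mul_prod (integrable_triangle.ofReal (𝕜 := ℂ))
    have hc : Continuous fun z : ℝ × ℝ => Complex.exp (Complex.I * z.2 * (y - z.1)) := by fun_prop
    refine (h2.bdd_mul (c := 1) hc.aestronglyMeasurable
      (Eventually.of_forall fun z => ?_)).congr (Eventually.of_forall fun z => ?_)
    · rw [Complex.norm_exp]
      simp
    · simp only [Function.uncurry]
      push_cast
      simp only [Complex.coe_algebraMap]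
      push_cast
      ring
  have hL : ∀ u : ℝ, ((f u * Real.exp (-(σ * u)) * fejerKernel (u - y) : ℝ) : ℂ) =
      ∫ t : ℝ, ((f u * Real.exp (-(σ * u)) : ℝ) : ℂ) *
        ((triangle t : ℂ) * Complex.exp (Complex.I * t * (y - u))) := by
    intro u
    rw [integral_const_mul, ← fejerKernel_neg, neg_sub, Complex.ofReal_mul,
      ← integral_triangle_mul_cexp]
    push_cast
    rfl
  simp_rw [hL]
  rw [integral_integral_swap hprod]
  refine integral_congr_ae (Eventually.of_forall fun t => ?_)
  simp only
  rw [← integral_const_mul]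
  refine integral_congr_ae (Eventually.of_forall fun u => ?_)
  simp only
  have : Complex.exp (Complex.I * t * (y - u)) * Complex.exp (-(σ * u)) =
      Complex.exp (Complex.I * t * y) * Complex.exp (-((σ + Complex.I * t) * u)) := by
    rw [← Complex.exp_add, ← Complex.exp_add]
    congr 1
    ring
  push_cast
  linear_combination (f u : ℂ) * (triangle t : ℂ) * this

/-- The undamped limit `σ → 0⁺` of `integral_mul_exp_mul_fejerKernel`: if the Laplace transform of `f`
extends continuously to the closed half-plane, its boundary values compute the Fejér averages
of `f`. -/
lemma integral_mul_fejerKernel_eq_integral_boundary {f : ℝ → ℝ} {C : ℝ} (hm : Measurable f)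
    (hb : ∀ u, |f u| ≤ C) {G : ℂ → ℂ} (hG : ContinuousOn G {s | 0 ≤ s.re})
    (hGe : ∀ s : ℂ, 0 < s.re →
      G s = ∫ u in Set.Ioi (0 : ℝ), (f u : ℂ) * Complex.exp (-(s * u))) (y : ℝ) :
    ((∫ u in Set.Ioi (0 : ℝ), f u * fejerKernel (u - y) : ℝ) : ℂ) =
      ∫ t : ℝ, (triangle t : ℂ) * Complex.exp (Complex.I * t * y) * G (Complex.I * t) := by
  have hmK : Measurable fun u : ℝ => fejerKernel (u - y) :=
    (continuous_fejerKernel.comp (continuous_id.sub continuous_const)).measurable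
  have hiK : Integrable fun u : ℝ => fejerKernel (u - y) := integrable_fejerKernel.comp_sub_right y
  have hC : 0 ≤ C := (abs_nonneg _).trans (hb 0)
  have hleft : Tendsto (fun σ : ℝ => ∫ u in Set.Ioi (0 : ℝ),
      ((f u * Real.exp (-(σ * u)) * fejerKernel (u - y) : ℝ) : ℂ)) (𝓝[>] 0)
      (𝓝 ((∫ u in Set.Ioi (0 : ℝ), f u * fejerKernel (u - y) : ℝ) : ℂ)) := by
    rw [← integral_complex_ofReal]
    refine tendsto_integral_filter_of_dominated_convergence
      (fun u => C * fejerKernel (u - y)) ?_ ?_ (hiK.const_mul C).integrableOn ?_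
    · refine Eventually.of_forall fun σ => Measurable.aestronglyMeasurable ?_
      fun_prop
    · filter_upwards [self_mem_nhdsWithin] with σ hσ
      filter_upwards [ae_restrict_mem measurableSet_Ioi] with u hu
      have hσu : 0 ≤ σ * u := mul_nonneg (le_of_lt hσ) (le_of_lt hu)
      rw [Complex.norm_real, norm_mul, norm_mul, Real.norm_of_nonneg (fejerKernel_nonneg _),
        Real.norm_of_nonneg (Real.exp_pos _).le]
      have h1 : Real.exp (-(σ * u)) ≤ 1 := Real.exp_le_one_iff.2 (by linarith)
      have h2 : ‖f u‖ * Real.exp (-(σ * u)) ≤ C * 1 :=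
        mul_le_mul (hb u) h1 (Real.exp_pos _).le hC
      rw [mul_one] at h2
      exact mul_le_mul_of_nonneg_right h2 (fejerKernel_nonneg _)
    · refine Eventually.of_forall fun u => ?_
      have hc : Continuous fun σ : ℝ =>
          ((f u * Real.exp (-(σ * u)) * fejerKernel (u - y) : ℝ) : ℂ) := by fun_prop
      have := (hc.tendsto 0).mono_left (nhdsWithin_le_nhds (s := Set.Ioi 0))
      simpa using this
  -- For `0 ≤ σ ≤ 1` and `|t| ≤ 1` the points `σ + i t` stay in a compact rectangle, so `G` is bounded
  -- there; this dominates the right-hand side.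
  have hcompact : IsCompact (Set.Icc (0 : ℝ) 1 ×ℂ Set.Icc (-1 : ℝ) 1) :=
    isCompact_Icc.reProdIm isCompact_Icc
  obtain ⟨B, hB⟩ := hcompact.exists_bound_of_continuousOn
    (hG.mono fun s hs => (Complex.mem_reProdIm.1 hs).1.1)
  have hcurve : ∀ σ : ℝ, 0 ≤ σ → Continuous fun t : ℝ => G (σ + Complex.I * t) := by
    intro σ hσ
    refine hG.comp_continuous (by fun_prop) fun t => ?_
    simpa using hσ
  have hright : Tendsto (fun σ : ℝ => ∫ t : ℝ, (triangle t : ℂ) *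
      Complex.exp (Complex.I * t * y) * G (σ + Complex.I * t)) (𝓝[>] 0)
      (𝓝 (∫ t : ℝ, (triangle t : ℂ) * Complex.exp (Complex.I * t * y) * G (Complex.I * t))) := by
    refine tendsto_integral_filter_of_dominated_convergence
      (fun t => triangle t * B) ?_ ?_ (integrable_triangle.mul_const B) ?_
    · filter_upwards [self_mem_nhdsWithin] with σ hσ
      have h1 := hcurve σ (le_of_lt hσ)
      have h2 := continuous_triangle
      have h3 : Continuous fun t : ℝ => (triangle t : ℂ) * Complex.exp (Complex.I * t * y) := by
        fun_prop
      exact (h3.mul h1).aestronglyMeasurable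
    · filter_upwards [Ioc_mem_nhdsGT (zero_lt_one' ℝ)] with σ hσ
      refine Eventually.of_forall fun t => ?_
      rw [norm_mul, norm_mul, Complex.norm_real, Real.norm_of_nonneg (triangle_nonneg t),
        Complex.norm_exp]
      rcases le_or_gt 1 |t| with ht | ht
      · simp [triangle_eq_zero ht]
      · have := hB (σ + Complex.I * t) (Complex.mem_reProdIm.2
          ⟨by simpa using ⟨hσ.1.le, hσ.2⟩, by simpa using abs_le.1 ht.le⟩)
        have h0 : (Complex.I * t * y).re = 0 := by simp
        rw [h0, Real.exp_zero, mul_one]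
        exact mul_le_mul_of_nonneg_left this (triangle_nonneg t)
    · refine Eventually.of_forall fun t => Tendsto.const_mul _ ?_
      have h1 : Tendsto (fun σ : ℝ => (σ + Complex.I * t : ℂ)) (𝓝[>] 0)
          (𝓝[{s | 0 ≤ s.re}] (Complex.I * t)) := by
        refine tendsto_nhdsWithin_iff.2 ⟨?_, ?_⟩
        · have hc : Continuous fun σ : ℝ => (σ + Complex.I * t : ℂ) := by fun_prop
          simpa using (hc.tendsto 0).mono_left (nhdsWithin_le_nhds (s := Set.Ioi 0))
        · filter_upwards [self_mem_nhdsWithin] with σ hσ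
          simpa using le_of_lt hσ
      exact (hG (Complex.I * t) (by simp)).tendsto.comp h1
  refine tendsto_nhds_unique hleft (hright.congr' ?_)
  filter_upwards [self_mem_nhdsWithin] with σ hσ
  rw [integral_mul_exp_mul_fejerKernel hm hb hσ y]
  refine integral_congr_ae (Eventually.of_forall fun t => ?_)
  simp only
  rw [hGe _ (by simpa using hσ)]

/-- By the Riemann–Lebesgue lemma, Fejér averages of `φ` at unit scale behave as if `φ` were `1`. -/
lemma tendsto_integral_mul_fejerKernel {φ : ℝ → ℝ} {C : ℝ} (hm : Measurable φ)
    (hb : ∀ u, |φ u| ≤ C) (hz : ∀ u ≤ 0, φ u = 0)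
    {G : ℂ → ℂ} (hG : ContinuousOn G {s | 0 ≤ s.re})
    (hGe : ∀ s : ℂ, 0 < s.re →
      G s = ∫ u in Set.Ioi (0 : ℝ), ((φ u - 1 : ℝ) : ℂ) * Complex.exp (-(s * u))) :
    Tendsto (fun y => ∫ v, φ (y + v) * fejerKernel v) atTop (𝓝 (∫ v, fejerKernel v)) := by
  have hb' : ∀ u, |φ u - 1| ≤ C + 1 := fun u =>
    (abs_sub _ _).trans (by simpa using hb u)
  have hRL : Tendsto (fun y : ℝ => ∫ t : ℝ, (triangle t : ℂ) *
      Complex.exp (Complex.I * t * y) * G (Complex.I * t)) atTop (𝓝 0) := by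
    have h1 := Real.tendsto_integral_exp_smul_cocompact
      (fun t : ℝ => (triangle t : ℂ) * G (Complex.I * t))
    have h2 : Tendsto (fun y : ℝ => -(y / (2 * Real.pi))) atTop (cocompact ℝ) :=
      (tendsto_neg_atTop_atBot.comp
        (tendsto_id.atTop_div_const (by positivity))).mono_right atBot_le_cocompact
    refine (h1.comp h2).congr fun y => integral_congr_ae (Eventually.of_forall fun t => ?_)
    simp only [Circle.smul_def, Real.fourierChar_apply, smul_eq_mul]
    have : ((2 * Real.pi * -(t * -(y / (2 * Real.pi))) : ℝ) : ℂ) * Complex.I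
        = Complex.I * t * y := by
      have hpi := Real.pi_ne_zero
      rw [show 2 * Real.pi * -(t * -(y / (2 * Real.pi))) = t * y by field_simp]
      push_cast; ring
    rw [this]
    ring
  have hreal : Tendsto (fun y : ℝ => ∫ u in Set.Ioi (0 : ℝ), (φ u - 1) * fejerKernel (u - y))
      atTop (𝓝 0) := by
    have := (hRL.congr fun y => (integral_mul_fejerKernel_eq_integral_boundary
      (hm.sub_const 1) hb' hG hGe y).symm)
    rw [← Complex.ofReal_zero] at this
    exact tendsto_ofReal_iff.1 this
  have htail : Tendsto (fun y : ℝ => ∫ u in Set.Ioi (0 : ℝ), fejerKernel (u - y)) atTop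
      (𝓝 (∫ v, fejerKernel v)) := by
    have hsub : ∀ y : ℝ, ∫ u in Set.Ioi (0 : ℝ), fejerKernel (u - y) =
        ∫ v in Set.Ioi (-y), fejerKernel v := by
      intro y
      have := (measurePreserving_sub_right volume y).setIntegral_preimage_emb
        (Homeomorph.subRight y).measurableEmbedding fejerKernel (Set.Ioi (-y))
      simpa using this
    simp_rw [hsub]
    have := (aecover_Ioi (μ := volume) tendsto_neg_atTop_atBot
      (α := ℝ)).integral_tendsto_of_countably_generated integrable_fejerKernel
    exact this
  have hsum := hreal.add htail
  rw [zero_add] at hsum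
  refine hsum.congr fun y => ?_
  have hiK : Integrable fun u : ℝ => fejerKernel (u - y) := integrable_fejerKernel.comp_sub_right y
  have hi1 : Integrable fun u : ℝ => (φ u - 1) * fejerKernel (u - y) :=
    hiK.bdd_mul (c := C + 1) (hm.sub_const 1).aestronglyMeasurable (Eventually.of_forall hb')
  rw [← integral_add hi1.integrableOn hiK.integrableOn]
  have h1 : ∀ u, (φ u - 1) * fejerKernel (u - y) + fejerKernel (u - y) =
      φ u * fejerKernel (u - y) := fun u => by ring
  simp_rw [h1]
  rw [setIntegral_eq_integral_of_forall_compl_eq_zero]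
  · rw [← integral_add_left_eq_self _ y]
    simp
  · intro u hu
    simp [hz u (by simpa using hu)]

/-! ### The Wiener–Ikehara theorem -/

/-- The same at an arbitrary scale `r`, since `u ↦ φ (r * u)` satisfies the same hypotheses. -/
lemma tendsto_integral_dilate_mul_fejerKernel {φ : ℝ → ℝ} {C : ℝ} (hm : Measurable φ)
    (hb : ∀ u, |φ u| ≤ C) (hz : ∀ u ≤ 0, φ u = 0)
    {G : ℂ → ℂ} (hG : ContinuousOn G {s | 0 ≤ s.re})
    (hGe : ∀ s : ℂ, 0 < s.re →
      G s = ∫ u in Set.Ioi (0 : ℝ), ((φ u - 1 : ℝ) : ℂ) * Complex.exp (-(s * u)))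
    {r : ℝ} (hr : 0 < r) :
    Tendsto (fun y => ∫ v, φ (y + r * v) * fejerKernel v) atTop (𝓝 (∫ v, fejerKernel v)) := by
  have key := tendsto_integral_mul_fejerKernel (φ := fun u => φ (r * u)) (C := C)
    (G := fun s => (r⁻¹ : ℝ) • G ((r⁻¹ : ℝ) * s)) (hm.comp (measurable_const_mul r)) (fun u => hb _)
    (fun u hu => hz _ (mul_nonpos_of_nonneg_of_nonpos hr.le hu)) ?_ ?_
  · refine (key.comp (tendsto_id.atTop_div_const hr)).congr fun y => ?_
    simp only [Function.comp, id]
    simp_rw [mul_add, mul_div_cancel₀ _ hr.ne']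
  · have h : ContinuousOn (fun s : ℂ => G ((r⁻¹ : ℝ) * s)) {s | 0 ≤ s.re} := by
      refine hG.comp (continuous_const.mul continuous_id).continuousOn fun s hs => ?_
      have hs' : 0 ≤ s.re := hs
      have : 0 ≤ r⁻¹ * s.re := by positivity
      simpa using this
    exact h.const_smul r⁻¹
  · intro s hs
    have h : 0 < (((r⁻¹ : ℝ) : ℂ) * s).re := by
      rw [Complex.re_ofReal_mul]; positivity
    rw [hGe _ h]
    have := integral_comp_mul_left_Ioi (fun u : ℝ => ((φ u - 1 : ℝ) : ℂ) *
      Complex.exp (-(((r⁻¹ : ℝ) : ℂ) * s * u))) 0 hr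
    rw [mul_zero] at this
    rw [← this]
    refine integral_congr_ae (Eventually.of_forall fun u => ?_)
    have hr' : (r : ℂ) ≠ 0 := by exact_mod_cast hr.ne'
    simp only
    congr 3
    push_cast
    field_simp

/-- A **Wiener–Ikehara theorem** for bounded functions: if `φ u * eᵘ` is monotone and the Laplace
transform of `φ - 1` extends continuously to the closed half-plane `Re s ≥ 0`, then `φ → 1`. -/
theorem tendsto_one_of_continuousOn_laplace {φ : ℝ → ℝ} {C : ℝ} (hm : Measurable φ)
    (h0 : ∀ u, 0 ≤ φ u) (hC : ∀ u, φ u ≤ C) (hz : ∀ u ≤ 0, φ u = 0)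
    (hmono : Monotone fun u => φ u * Real.exp u)
    {G : ℂ → ℂ} (hG : ContinuousOn G {s | 0 ≤ s.re})
    (hGe : ∀ s : ℂ, 0 < s.re →
      G s = ∫ u in Set.Ioi (0 : ℝ), ((φ u - 1 : ℝ) : ℂ) * Complex.exp (-(s * u))) :
    Tendsto φ atTop (𝓝 1) := by
  have hb : ∀ u, |φ u| ≤ C := fun u => by rw [abs_of_nonneg (h0 u)]; exact hC u
  have hC0 : 0 ≤ C := (h0 0).trans (hC 0)
  set c := ∫ v, fejerKernel v with hc
  have hcpos : 0 < c := integral_fejerKernel_pos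
  set I : ℝ → ℝ := fun R => ∫ v in Set.Ioc (-R) R, fejerKernel v with hI
  have hIc : Tendsto I atTop (𝓝 c) :=
    (aecover_Ioc (μ := volume) tendsto_neg_atTop_atBot
      tendsto_id).integral_tendsto_of_countably_generated integrable_fejerKernel
  have hav : ∀ r : ℝ, 0 < r → Tendsto (fun y => ∫ v, φ (y + r * v) * fejerKernel v) atTop (𝓝 c) :=
    fun r hr => tendsto_integral_dilate_mul_fejerKernel hm hb hz hG hGe hr
  have hint : ∀ y r : ℝ, Integrable fun v => φ (y + r * v) * fejerKernel v := fun y r =>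
    integrable_fejerKernel.bdd_mul (c := C)
      (hm.comp (by fun_prop)).aestronglyMeasurable (Eventually.of_forall fun u => hb _)
  have hslow : ∀ u w, u ≤ w → φ u ≤ φ w * Real.exp (w - u) := by
    intro u w huw
    rw [Real.exp_sub, ← mul_div_assoc, le_div_iff₀ (Real.exp_pos _)]
    exact hmono huw
  -- The kernel is used at scale `R⁻²`: the window `|v| ≤ R`, which carries almost all of its mass,
  -- corresponds to the short interval of radius `R⁻¹`.
  have hscale : ∀ R : ℝ, 0 < R → ∀ v ∈ Set.Ioc (-R) R, |R⁻¹ ^ 2 * v| ≤ R⁻¹ := by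
    intro R hR v hv
    rw [abs_mul, abs_of_pos (by positivity), sq, mul_assoc]
    have : |v| ≤ R := abs_le.2 ⟨hv.1.le, hv.2⟩
    have h2 : R⁻¹ * |v| ≤ 1 := by
      rw [inv_mul_le_iff₀ hR]; simpa using this
    exact mul_le_of_le_one_right (by positivity) h2
  have hinv : Tendsto (fun R : ℝ => R⁻¹) atTop (𝓝 0) := tendsto_inv_atTop_zero
  have hexp : Tendsto (fun R : ℝ => Real.exp (2 * R⁻¹)) atTop (𝓝 1) := by
    have := (Real.continuous_exp.tendsto (2 * 0)).comp (hinv.const_mul 2)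
    simpa [Function.comp_def] using this
  -- Average around `y + R⁻¹`: on the window, the argument of `φ` lies in `[y, y + 2 * R⁻¹]`, where
  -- `φ` is at least `φ y * exp (-2 * R⁻¹)`.
  have hupper : ∀ R : ℝ, 0 < R → ∀ᶠ y in atTop,
      φ y * I R ≤ Real.exp (2 * R⁻¹) * (c + R⁻¹) := by
    intro R hR
    have hR' : 0 < R⁻¹ := inv_pos.2 hR
    have h1 := (hav (R⁻¹ ^ 2) (by positivity)).comp
      (tendsto_atTop_add_const_right atTop R⁻¹ tendsto_id)
    filter_upwards [h1.eventually (gt_mem_nhds (show c < c + R⁻¹ by linarith))] with y hy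
    simp only [Function.comp, id] at hy
    have h2 : ∫ v in Set.Ioc (-R) R, φ y * Real.exp (-(2 * R⁻¹)) * fejerKernel v ≤
        ∫ v, φ (y + R⁻¹ + R⁻¹ ^ 2 * v) * fejerKernel v := by
      refine (setIntegral_mono_on (integrable_fejerKernel.const_mul _).integrableOn
        (hint _ _).integrableOn measurableSet_Ioc fun v hv => ?_).trans
        (setIntegral_le_integral (hint _ _) (Eventually.of_forall fun v =>
          mul_nonneg (h0 _) (fejerKernel_nonneg v)))
      have h3 := abs_le.1 (hscale R hR v hv)
      refine mul_le_mul_of_nonneg_right ?_ (fejerKernel_nonneg v)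
      have h4 := hslow y (y + R⁻¹ + R⁻¹ ^ 2 * v) (by linarith [h3.1])
      have h5 : Real.exp (y + R⁻¹ + R⁻¹ ^ 2 * v - y) ≤ Real.exp (2 * R⁻¹) :=
        Real.exp_le_exp.2 (by linarith [h3.2])
      rw [Real.exp_neg, ← div_eq_mul_inv, div_le_iff₀ (Real.exp_pos _)]
      exact h4.trans (mul_le_mul_of_nonneg_left h5 (h0 _))
    rw [integral_const_mul] at h2
    have h6 : φ y * Real.exp (-(2 * R⁻¹)) * I R ≤ c + R⁻¹ := h2.trans hy.le
    rw [Real.exp_neg] at h6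
    have hE := Real.exp_pos (2 * R⁻¹)
    calc φ y * I R = Real.exp (2 * R⁻¹) * (φ y * (Real.exp (2 * R⁻¹))⁻¹ * I R) := by
          field_simp
      _ ≤ _ := mul_le_mul_of_nonneg_left h6 hE.le
  -- Average around `y - R⁻¹`: on the window, `φ` is at most `φ y * exp (2 * R⁻¹)`; off the window the
  -- bound `C` is enough.
  have hlower : ∀ R : ℝ, 0 < R → ∀ᶠ y in atTop,
      c - R⁻¹ - C * (c - I R) ≤ φ y * Real.exp (2 * R⁻¹) * c := by
    intro R hR
    have hR' : 0 < R⁻¹ := inv_pos.2 hR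
    have h1 := (hav (R⁻¹ ^ 2) (by positivity)).comp
      (tendsto_atTop_add_const_right atTop (-R⁻¹) tendsto_id)
    filter_upwards [h1.eventually (lt_mem_nhds (show c - R⁻¹ < c by linarith))] with y hy
    simp only [Function.comp, id] at hy
    rw [← integral_add_compl (measurableSet_Ioc (a := -R) (b := R)) (hint _ _)] at hy
    have hin : ∫ v in Set.Ioc (-R) R, φ (y + -R⁻¹ + R⁻¹ ^ 2 * v) * fejerKernel v ≤
        φ y * Real.exp (2 * R⁻¹) * c := by
      refine (setIntegral_mono_on (hint _ _).integrableOn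
        (integrable_fejerKernel.const_mul (φ y * Real.exp (2 * R⁻¹))).integrableOn
        measurableSet_Ioc fun v hv => ?_).trans ?_
      · have h3 := abs_le.1 (hscale R hR v hv)
        refine mul_le_mul_of_nonneg_right ?_ (fejerKernel_nonneg v)
        refine (hslow _ y (by linarith [h3.2])).trans
          (mul_le_mul_of_nonneg_left (Real.exp_le_exp.2 ?_) (h0 _))
        linarith [h3.1]
      · rw [integral_const_mul]
        refine mul_le_mul_of_nonneg_left ?_ (mul_nonneg (h0 _) (Real.exp_pos _).le)
        exact setIntegral_le_integral integrable_fejerKernel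
          (Eventually.of_forall fejerKernel_nonneg)
    have hout : ∫ v in (Set.Ioc (-R) R)ᶜ, φ (y + -R⁻¹ + R⁻¹ ^ 2 * v) * fejerKernel v ≤
        C * (c - I R) := by
      have h7 : c - I R = ∫ v in (Set.Ioc (-R) R)ᶜ, fejerKernel v := by
        rw [hc, ← integral_add_compl (measurableSet_Ioc (a := -R) (b := R))
          integrable_fejerKernel, hI]
        ring
      rw [h7, ← integral_const_mul]
      exact setIntegral_mono (hint _ _).integrableOn
        (integrable_fejerKernel.const_mul C).integrableOn
        fun v => mul_le_mul_of_nonneg_right (hC _) (fejerKernel_nonneg v)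
    linarith
  refine tendsto_order.2 ⟨fun a ha => ?_, fun a ha => ?_⟩
  · have hlim : Tendsto (fun R => c - R⁻¹ - C * (c - I R) - a * Real.exp (2 * R⁻¹) * c) atTop
        (𝓝 (c - 0 - C * (c - c) - a * 1 * c)) :=
      ((hinv.const_sub c).sub ((hIc.const_sub c).const_mul C)).sub
        ((hexp.const_mul a).mul_const c)
    have hpos : 0 < c - 0 - C * (c - c) - a * 1 * c := by
      have := mul_lt_mul_of_pos_right ha hcpos
      linarith
    obtain ⟨R, hR1, hR⟩ := ((hlim.eventually (lt_mem_nhds hpos)).and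
      (eventually_gt_atTop 0)).exists
    filter_upwards [hlower R hR] with y hy
    have : a * (Real.exp (2 * R⁻¹) * c) < φ y * (Real.exp (2 * R⁻¹) * c) := by linarith
    exact lt_of_mul_lt_mul_right this (by positivity)
  · have hlim : Tendsto (fun R => a * I R - Real.exp (2 * R⁻¹) * (c + R⁻¹)) atTop
        (𝓝 (a * c - 1 * (c + 0))) :=
      (hIc.const_mul a).sub (hexp.mul (hinv.const_add c))
    have hpos : 0 < a * c - 1 * (c + 0) := by
      have := mul_lt_mul_of_pos_right ha hcpos
      linarith
    obtain ⟨R, hR1, hR, hR2⟩ := ((hlim.eventually (lt_mem_nhds hpos)).and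
      ((eventually_gt_atTop 0).and (hIc.eventually (lt_mem_nhds hcpos)))).exists
    filter_upwards [hupper R hR] with y hy
    exact lt_of_mul_lt_mul_right (show φ y * I R < a * I R by linarith) hR2.le

/-! ### Asymptotics of the Chebyshev function `ψ` -/

open ArithmeticFunction ArithmeticFunction.vonMangoldt in
/-- `-ζ'/ζ(s) - 1/(s - 1)` extends continuously to `Re s ≥ 1`. This is the case of modulus `1` of the
analytic input to Dirichlet's theorem on primes in arithmetic progressions. -/
lemma exists_continuousOn_eq_LSeries_vonMangoldt_sub :
    ∃ F : ℂ → ℂ, ContinuousOn F {s | 1 ≤ s.re} ∧ ∀ s : ℂ, 1 < s.re →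
      F s = LSeries (fun n => (vonMangoldt n : ℂ)) s - 1 / (s - 1) := by
  refine ⟨LFunctionResidueClassAux (1 : ZMod 1), continuousOn_LFunctionResidueClassAux 1,
    fun s hs => ?_⟩
  have h := eqOn_LFunctionResidueClassAux (q := 1) (a := 1) isUnit_one hs
  have hr : residueClass (1 : ZMod 1) = fun n => vonMangoldt n := by
    ext n
    have hn : n ∈ {m : ℕ | (m : ZMod 1) = 1} := Subsingleton.elim (n : ZMod 1) 1
    exact Set.indicator_of_mem hn _
  simpa [hr] using h

open Chebyshev in
theorem tendsto_psi_exp_div_exp :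
    Tendsto (fun u : ℝ => psi (Real.exp u) / Real.exp u) atTop (𝓝 1) := by
  obtain ⟨F, hF, hFe⟩ := exists_continuousOn_eq_LSeries_vonMangoldt_sub
  have hbound : ∀ u : ℝ, psi (Real.exp u) / Real.exp u ≤ Real.log 4 + 4 := fun u => by
    rw [div_le_iff₀ (Real.exp_pos _)]
    exact psi_le_const_mul_self (Real.exp_pos _).le
  have hnonneg : ∀ u : ℝ, 0 ≤ psi (Real.exp u) / Real.exp u := fun u =>
    div_nonneg (psi_nonneg _) (Real.exp_pos _).le
  have hmeas : Measurable fun u : ℝ => psi (Real.exp u) / Real.exp u :=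
    (psi_mono.measurable.comp Real.measurable_exp).div Real.measurable_exp
  refine tendsto_one_of_continuousOn_laplace (C := Real.log 4 + 4)
    (G := fun s => (F (1 + s) - 1) / (1 + s)) hmeas hnonneg hbound ?_ ?_ ?_ ?_
  · intro u hu
    rw [psi_eq_zero_of_le_one (Real.exp_le_one_iff.2 hu), zero_div]
  · intro u v huv
    simp only [div_mul_cancel₀ _ (Real.exp_pos _).ne']
    exact psi_mono (Real.exp_le_exp.2 huv)
  · have hre : ∀ s : ℂ, 0 ≤ s.re → (1 : ℝ) ≤ (1 + s).re := fun s hs => by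
      simpa using hs
    refine ContinuousOn.div ((hF.comp (continuous_const.add continuous_id).continuousOn
      fun s hs => hre s hs).sub continuousOn_const)
      (continuous_const.add continuous_id).continuousOn fun s hs h => ?_
    have := hre s hs
    have h' : (1 + s : ℂ) = 0 := h
    rw [h'] at this
    norm_num at this
  · intro s hs
    have hs0 : s ≠ 0 := fun h => by simp [h] at hs
    have hs1re : 1 < (1 + s).re := by simpa using hs
    have hs1 : 1 + s ≠ 0 := fun h => by rw [h] at hs1re; norm_num at hs1re
    have hO : (fun n : ℕ => ∑ k ∈ Finset.Icc 1 n, ArithmeticFunction.vonMangoldt k) =O[atTop]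
        fun n : ℕ => (n : ℝ) ^ (1 : ℝ) := by
      refine IsBigO.of_bound (Real.log 4 + 4) (Eventually.of_forall fun n => ?_)
      have h1 : ∑ k ∈ Finset.Icc 1 n, ArithmeticFunction.vonMangoldt k = psi n := by
        simp [psi, ← Finset.Icc_add_one_left_eq_Ioc]
      rw [h1, Real.rpow_one, Real.norm_of_nonneg (psi_nonneg _),
        Real.norm_of_nonneg (Nat.cast_nonneg _)]
      exact psi_le_const_mul_self (Nat.cast_nonneg _)
    have hL := LSeries_eq_mul_integral_of_nonneg (fun n => ArithmeticFunction.vonMangoldt n)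
      zero_le_one hs1re hO (fun n => ArithmeticFunction.vonMangoldt_nonneg)
    have hsub := integral_comp_exp_Ioi (fun t : ℝ => (∑ k ∈ Finset.Icc 1 ⌊t⌋₊,
      (ArithmeticFunction.vonMangoldt k : ℂ)) * (t : ℂ) ^ (-(1 + s + 1))) 0
    rw [Real.exp_zero] at hsub
    rw [← hsub] at hL
    have hcongr : ∫ u in Set.Ioi (0 : ℝ), Real.exp u •
        ((∑ k ∈ Finset.Icc 1 ⌊Real.exp u⌋₊, (ArithmeticFunction.vonMangoldt k : ℂ)) *
          (Real.exp u : ℂ) ^ (-(1 + s + 1))) =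
        ∫ u in Set.Ioi (0 : ℝ), ((psi (Real.exp u) / Real.exp u : ℝ) : ℂ) *
          Complex.exp (-s * u) := by
      refine integral_congr_ae (Eventually.of_forall fun u => ?_)
      have h1 : ∑ k ∈ Finset.Icc 1 ⌊Real.exp u⌋₊, (ArithmeticFunction.vonMangoldt k : ℂ) =
          (psi (Real.exp u) : ℂ) := by
        simp [psi, ← Finset.Icc_add_one_left_eq_Ioc]
      have h2 : (Real.exp u : ℂ) ^ (-(1 + s + 1)) = Complex.exp (u * (-(1 + s + 1))) := by
        rw [Complex.cpow_def_of_ne_zero (by exact_mod_cast (Real.exp_pos u).ne'),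
          ← Complex.ofReal_log (Real.exp_pos u).le, Real.log_exp]
      have h3 : Complex.exp (u * (-(1 + s + 1))) * Complex.exp u * Complex.exp u =
          Complex.exp (-s * u) := by
        rw [← Complex.exp_add, ← Complex.exp_add]
        congr 1
        ring
      simp only [Complex.real_smul]
      rw [h1, h2, ← h3]
      push_cast
      have := Complex.exp_ne_zero (u : ℂ)
      field_simp
    rw [hcongr] at hL
    have hre : (-s).re < 0 := by simpa using hs
    have hexp : ∫ u in Set.Ioi (0 : ℝ), Complex.exp (-s * u) = 1 / s := by
      rw [integral_exp_mul_complex_Ioi hre]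
      simp
    have hi := integrableOn_exp_mul_complex_Ioi hre 0
    have hi2 : IntegrableOn (fun u : ℝ => ((psi (Real.exp u) / Real.exp u : ℝ) : ℂ) *
        Complex.exp (-s * u)) (Set.Ioi 0) := by
      refine hi.bdd_mul (c := Real.log 4 + 4)
        (Complex.measurable_ofReal.comp hmeas).aestronglyMeasurable
        (Eventually.of_forall fun u => ?_)
      rw [Complex.norm_real, Real.norm_of_nonneg (hnonneg u)]
      exact hbound u
    have hsplit : ∫ u in Set.Ioi (0 : ℝ), (((psi (Real.exp u) / Real.exp u - 1 : ℝ)) : ℂ) *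
        Complex.exp (-(s * u)) = (∫ u in Set.Ioi (0 : ℝ),
          ((psi (Real.exp u) / Real.exp u : ℝ) : ℂ) * Complex.exp (-s * u)) - 1 / s := by
      rw [← hexp, ← integral_sub hi2 hi]
      refine integral_congr_ae (Eventually.of_forall fun u => ?_)
      simp only [neg_mul]
      push_cast
      ring
    rw [hsplit, hFe _ hs1re, hL, add_sub_cancel_left]
    field_simp
    ring

theorem psi_isEquivalent_id : Chebyshev.psi ~[atTop] id := by
  rw [isEquivalent_iff_tendsto_one (by filter_upwards [eventually_ne_atTop 0] with x hx using hx)]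
  refine (tendsto_psi_exp_div_exp.comp Real.tendsto_log_atTop).congr' ?_
  filter_upwards [eventually_gt_atTop 0] with x hx
  simp [Real.exp_log hx]

/-! ### The prime number theorem -/

theorem theta_isEquivalent_id : Chebyshev.theta ~[atTop] id := by
  have hsqrt : Real.sqrt =o[atTop] (id : ℝ → ℝ) := by
    have h1 : (fun _ : ℝ => (1 : ℝ)) =o[atTop] Real.sqrt :=
      isLittleO_const_left.2 (Or.inr (tendsto_norm_atTop_atTop.comp Real.tendsto_sqrt_atTop))
    refine ((isBigO_refl Real.sqrt atTop).mul_isLittleO h1).congr'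
      (Eventually.of_forall fun x => mul_one _) ?_
    filter_upwards [eventually_ge_atTop 0] with x hx using Real.mul_self_sqrt hx
  have h := psi_isEquivalent_id.sub_isLittleO
    (Chebyshev.isBigO_psi_sub_theta_sqrt.trans_isLittleO hsqrt)
  rwa [sub_sub_cancel] at h

/-- The **prime number theorem**. -/
theorem primeCounting_isEquivalent :
    (fun x : ℝ => (Nat.primeCounting ⌊x⌋₊ : ℝ)) ~[atTop] fun x => x / Real.log x := by
  have h1 : (fun x => Chebyshev.theta x / Real.log x) ~[atTop] fun x => x / Real.log x :=
    theta_isEquivalent_id.div IsEquivalent.refl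
  have h2 : (fun x : ℝ => x / Real.log x ^ 2) =o[atTop] fun x => x / Real.log x := by
    refine (isLittleO_iff_tendsto' ?_).2 ?_
    · filter_upwards [eventually_gt_atTop 1] with x hx h
      have : 0 < x / Real.log x := div_pos (by linarith) (Real.log_pos hx)
      exact absurd h this.ne'
    · refine Tendsto.congr' ?_ Real.tendsto_log_atTop.inv_tendsto_atTop
      filter_upwards [eventually_gt_atTop 1] with x hx
      have : 0 < Real.log x := Real.log_pos hx
      simp only [Pi.inv_apply]
      field_simp
  have h3 := h1.add_isLittleO
    (Chebyshev.primeCounting_sub_theta_div_log_isBigO.trans_isLittleO h2)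
  refine h3.congr_left (Eventually.of_forall fun x => ?_)
  simp

lemma primeCounting_nthPrime {n : ℕ} (hn : 1 ≤ n) : Nat.primeCounting (nthPrime n) = n := by
  unfold nthPrime Nat.primeCounting Nat.primeCounting'
  rw [Nat.count_nth_succ_of_infinite Nat.infinite_setOfPred_prime]
  omega

lemma nthPrime_mono : Monotone nthPrime := fun _ _ hab =>
  Nat.nth_monotone Nat.infinite_setOfPred_prime (Nat.sub_le_sub_right hab 1)

lemma tendsto_nthPrime : Tendsto (fun n => (nthPrime n : ℝ)) atTop atTop := by
  refine tendsto_natCast_atTop_atTop.comp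
    (tendsto_atTop_mono' _ ?_ (tendsto_sub_atTop_nat 1))
  filter_upwards with n
  exact (Nat.nth_strictMono Nat.infinite_setOfPred_prime).le_apply

theorem nthPrime_isEquivalent :
    (fun n : ℕ => (nthPrime n : ℝ)) ~[atTop] fun n => (n : ℝ) * Real.log n := by
  have hn : (fun n : ℕ => (n : ℝ)) ~[atTop]
      fun n => (nthPrime n : ℝ) / Real.log (nthPrime n) := by
    refine (primeCounting_isEquivalent.comp_tendsto tendsto_nthPrime).congr_left ?_
    filter_upwards [eventually_ge_atTop 1] with n h
    simp [primeCounting_nthPrime h]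
  -- Taking logarithms in `n ~ p / log p` gives `log n ~ log p - log (log p) ~ log p`.
  have hlog : (fun n : ℕ => Real.log n) ~[atTop] fun n => Real.log (nthPrime n) := by
    have h1 := hn.log (hn.tendsto_atTop tendsto_natCast_atTop_atTop)
    have hll : (fun n : ℕ => Real.log (Real.log (nthPrime n))) =o[atTop]
        fun n => Real.log (nthPrime n) :=
      Real.isLittleO_log_id_atTop.comp_tendsto (Real.tendsto_log_atTop.comp tendsto_nthPrime)
    refine h1.trans ((IsEquivalent.refl.sub_isLittleO hll).congr_left ?_)
    filter_upwards [tendsto_nthPrime.eventually (eventually_gt_atTop 1)] with n h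
    rw [Real.log_div (by positivity) (Real.log_pos h).ne']
    rfl
  have h := hn.mul hlog
  refine (h.congr_right ?_).symm
  filter_upwards [tendsto_nthPrime.eventually (eventually_gt_atTop 1)] with n h
  have := (Real.log_pos h).ne'
  simp only [Pi.mul_apply]
  field_simp

/-! ### Alternating sums of primes -/

lemma altA_succ (n : ℕ) :
    altA (n + 1) = altA n + ((nthPrime (2 * n + 2) : ℤ) - nthPrime (2 * n + 1)) := by
  unfold altA
  rw [show 2 * (n + 1) = 2 * n + 1 + 1 by ring, Finset.sum_Icc_succ_top (by omega),
    Finset.sum_Icc_succ_top (by omega)]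
  simp [pow_succ, pow_mul]
  ring

lemma altA_nonneg (n : ℕ) : 0 ≤ altA n := by
  induction n with
  | zero => simp [altA]
  | succ n ih =>
    have : (nthPrime (2 * n + 1) : ℤ) ≤ nthPrime (2 * n + 2) :=
      mod_cast nthPrime_mono (Nat.le_succ _)
    rw [altA_succ]
    omega

/-- The sign convention in Pillai's conjecture is opposite to that of `altA`; nonnegativity of `altA`
identifies it with the absolute value. -/
lemma altA_eq_abs (n : ℕ) :
    (altA n : ℝ) = |∑ i ∈ Finset.Icc 1 (2 * n), (-1 : ℝ) ^ (i - 1) * (nthPrime i : ℝ)| := by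
  have h : ∑ i ∈ Finset.Icc 1 (2 * n), (-1 : ℝ) ^ (i - 1) * (nthPrime i : ℝ) = -altA n := by
    unfold altA
    push_cast
    rw [← Finset.sum_neg_distrib]
    refine Finset.sum_congr rfl fun i hi => ?_
    obtain ⟨j, rfl⟩ := Nat.exists_eq_add_of_le' (Finset.mem_Icc.1 hi).1
    simp [pow_succ]
  rw [h, abs_neg, abs_of_nonneg (mod_cast altA_nonneg n)]

lemma altT_eq_altA_add_two {n : ℕ} (hn : 1 ≤ n) : altT n = altA n + 2 := by
  unfold altT altA
  rw [← Finset.add_sum_Ioc_eq_sum_Icc (show 1 ≤ 2 * n by omega), ← Finset.Icc_add_one_left_eq_Ioc]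
  simp [nthPrime, Nat.nth_prime_zero_eq_two]

lemma isLittleO_const_mul_log (c : ℝ) :
    (fun _ : ℕ => c) =o[atTop] fun n : ℕ => (n : ℝ) * Real.log n :=
  isLittleO_const_left.2 <| Or.inr <| tendsto_norm_atTop_atTop.comp <|
    tendsto_natCast_atTop_atTop.atTop_mul_atTop₀
      (Real.tendsto_log_atTop.comp tendsto_natCast_atTop_atTop)

lemma natCast_isLittleO_mul_log :
    (fun n : ℕ => (n : ℝ)) =o[atTop] fun n : ℕ => (n : ℝ) * Real.log n := by
  have h : (fun _ : ℕ => (1 : ℝ)) =o[atTop] fun n : ℕ => Real.log n :=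
    Real.isLittleO_const_log_atTop.comp_tendsto tendsto_natCast_atTop_atTop
  simpa using (isBigO_refl (fun n : ℕ => (n : ℝ)) atTop).mul_isLittleO h

lemma mul_log_log_isLittleO_mul_log :
    (fun n : ℕ => (n : ℝ) * Real.log (Real.log n)) =o[atTop]
      fun n : ℕ => (n : ℝ) * Real.log n :=
  (isBigO_refl (fun n : ℕ => (n : ℝ)) atTop).mul_isLittleO <|
    Real.isLittleO_log_id_atTop.comp_tendsto
      (Real.tendsto_log_atTop.comp tendsto_natCast_atTop_atTop)

lemma log_two_mul_isEquivalent :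
    (fun n : ℕ => Real.log ((2 * n : ℕ) : ℝ)) ~[atTop] fun n : ℕ => Real.log n := by
  have h : (fun _ : ℕ => Real.log 2) =o[atTop] fun n : ℕ => Real.log n :=
    Real.isLittleO_const_log_atTop.comp_tendsto tendsto_natCast_atTop_atTop
  refine (IsEquivalent.refl.add_isLittleO h).congr_left ?_
  filter_upwards [eventually_ge_atTop 1] with n hn
  rw [Nat.cast_mul, Real.log_mul (by norm_num) (by positivity)]
  simp [add_comm]

theorem altA_isEquivalent (hPillai : PillaiConjecture) :
    (fun n : ℕ => (altA n : ℝ)) ~[atTop] fun n : ℕ => (n : ℝ) * Real.log n := by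
  have h2 : Tendsto (fun n : ℕ => 2 * n) atTop atTop :=
    tendsto_id.const_mul_atTop' (by norm_num)
  have h3 : (fun n : ℕ => (altA n : ℝ)) ~[atTop] fun n : ℕ => (nthPrime (2 * n) : ℝ) / 2 :=
    (IsEquivalent.comp_tendsto hPillai h2).congr_left
      (Eventually.of_forall fun n => (altA_eq_abs n).symm)
  have h4 : (fun n : ℕ => (nthPrime (2 * n) : ℝ) / 2) ~[atTop]
      fun n : ℕ => (n : ℝ) * Real.log ((2 * n : ℕ) : ℝ) := by
    refine ((nthPrime_isEquivalent.comp_tendsto h2).div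
      (IsEquivalent.refl (u := fun _ : ℕ => (2 : ℝ)))).congr_right ?_
    refine Eventually.of_forall fun n => ?_
    simp only [Function.comp, Pi.div_apply]
    push_cast
    ring
  exact (h3.trans h4).trans (IsEquivalent.refl.mul log_two_mul_isEquivalent)

theorem corollary2p3 (hPillai : PillaiConjecture) :
    (IsEquivalent atTop (fun n : ℕ => (altA n : ℝ)) (fun n : ℕ => (altT n : ℝ)) ∧
      IsEquivalent atTop (fun n : ℕ => (altA n : ℝ)) (fun n : ℕ => (n : ℝ) * Real.log n) ∧
      IsEquivalent atTop (fun n : ℕ => (altT n : ℝ)) (fun n : ℕ => (n : ℝ) * Real.log n)) ∧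
    ∀ e : ℕ → ℝ, IsLittleO atTop e (fun n : ℕ => (n : ℝ)) →
      IsEquivalent atTop (fun n : ℕ => (altA n : ℝ))
        (fun n : ℕ => (n : ℝ) * Real.log n + n * Real.log (Real.log n) - n + e n) ∧
      IsEquivalent atTop (fun n : ℕ => (altT n : ℝ))
        (fun n : ℕ => (n : ℝ) * Real.log n + n * Real.log (Real.log n) - n + e n) := by
  have hA := altA_isEquivalent hPillai
  have hT : (fun n : ℕ => (altT n : ℝ)) ~[atTop] fun n : ℕ => (n : ℝ) * Real.log n := by
    refine (hA.add_isLittleO (isLittleO_const_mul_log 2)).congr_left ?_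
    filter_upwards [eventually_ge_atTop 1] with n hn
    simp [altT_eq_altA_add_two hn]
  refine ⟨⟨hA.trans hT.symm, hA, hT⟩, fun e he => ?_⟩
  have hM : (fun n : ℕ => (n : ℝ) * Real.log n + n * Real.log (Real.log n) - n + e n) ~[atTop]
      fun n : ℕ => (n : ℝ) * Real.log n :=
    ((IsEquivalent.refl.add_isLittleO mul_log_log_isLittleO_mul_log).sub_isLittleO
      natCast_isLittleO_mul_log).add_isLittleO (he.trans natCast_isLittleO_mul_log)
  exact ⟨hA.trans hM.symm, hT.trans hM.symm⟩
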